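/- Let $P$ be a smooth ($C^\infty$) finite-dimensional Hausdorff manifold without boundary, $\pi^*:T^*P\to P$ its cotangent bundle, and let $\mathrm{Aut}_0TP$ be the group, under composition, of smooth vector bundle automorphisms of $TP$ covering $\mathrm{id}_P$: an element $A$ is a family of linear isomorphisms $A(p):T_pP\to T_pP$ depending smoothly on $p$. A linear vector field on $T^*P$ is a pair $(\xi,\chi)$ of smooth vector fields on $T^*P$ and $P$ such that $\xi:T^*P\to T(T^*P)$ is a morphism of vector bundles over $\chi:P\to TP$; here $T\pi^*:T(T^*P)\to TP$ carries the vector bundle structure whose fibrewise addition and scalar multiplication are the tangent maps of those of $T^*P$. A generalized canonical form on $T^*P$ is a smooth one-form $\gamma$ on $T^*P$ such that (i) $\gamma_\varphi\neq 0$ for every $\varphi\in T^*P$ outside the zero section; (ii) $\ker T\pi^*(\varphi)\subset\ker\gamma_\varphi$ for every $\varphi\in T^*P$; (iii) for every linear vector field $(\xi,\chi)$ the function $\langle\gamma,\xi\rangle$ on $T^*P$ is smooth and linear on the fibres of $T^*P$. Let $\mathrm{Can}\,T^*P$ be the set of generalized canonical forms. Then: (1) The map $\Theta:\mathrm{Aut}_0TP\to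 \mathrm{Can}\,T^*P$ given by $$\langle\Theta(A)_\varphi,\xi_\varphi\rangle:=\langle\varphi,A(\pi^*(\varphi))\,T\pi^*(\varphi)\xi_\varphi\rangle,\qquad \xi_\varphi\in T_\varphi(T^*P),$$ is well defined (takes values in $\mathrm{Can}\,T^*P$) and bijective. (2) For $A\in\mathrm{Aut}_0TP$ let $A^*:T^*P\to T^*P$, $A^*(\varphi)=\varphi\circ A(\pi^*(\varphi))$, be its dual; it is smooth. The formula $$\langle (L^*_A\gamma)_\varphi,\xi_\varphi\rangle:=\langle\gamma_{A^*(\varphi)},TA^*(\varphi)\xi_\varphi\rangle$$ defines a left action $L^*:\mathrm{Aut}_0TP\times \mathrm{Can}\,T^*P\to \mathrm{Can}\,T^*P$, which is transitive and free. Furthermore $L^*_A\Theta(A')=\Theta(AA')$ for all $A,A'\in\mathrm{Aut}_0TP$. -/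

import Mathlib

open Bundle Set
open scoped Manifold ContDiff

noncomputable section

namespace GenCanForm

variable (E : Type*) [NormedAddCommGroup E] [NormedSpace ℝ E]
  (P : Type*) [TopologicalSpace P] [ChartedSpace E P]

/-- The cotangent bundle `T*P` (total space) of a manifold `P` modelled on `E`. -/
abbrev CotangentBundle : Type _ :=
  TotalSpace (E →L[ℝ] ℝ) (fun p : P => TangentSpace 𝓘(ℝ, E) p →L[ℝ] ℝ)

/-- The model of the manifold `T*P`, namely `E × E*`. -/
abbrev cotModel : ModelWithCorners ℝ (E × (E →L[ℝ] ℝ)) (ModelProd E (E →L[ℝ] ℝ)) :=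
  𝓘(ℝ, E).prod 𝓘(ℝ, E →L[ℝ] ℝ)

/-- The fibre product `T*P ×_P T*P`, whose points are triples `(p, φ, ψ)` with `φ, ψ ∈ T*_p P`. -/
abbrev CotangentBundleSq : Type _ :=
  TotalSpace ((E →L[ℝ] ℝ) × (E →L[ℝ] ℝ))
    ((fun p : P => TangentSpace 𝓘(ℝ, E) p →L[ℝ] ℝ) ×ᵇ
      (fun p : P => TangentSpace 𝓘(ℝ, E) p →L[ℝ] ℝ))

/-- The model of the manifold `T*P ×_P T*P`. -/
abbrev cotSqModel : ModelWithCorners ℝ (E × ((E →L[ℝ] ℝ) × (E →L[ℝ] ℝ)))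
    (ModelProd E ((E →L[ℝ] ℝ) × (E →L[ℝ] ℝ))) :=
  𝓘(ℝ, E).prod 𝓘(ℝ, (E →L[ℝ] ℝ) × (E →L[ℝ] ℝ))

variable [IsManifold 𝓘(ℝ, E) ∞ P]

/-- Smooth dependence on `p` of a family of linear maps `A(p) : T_p P → T_p P`: smoothness of the
corresponding section of the bundle `End(TP)`. -/
def SmoothEnd (A : ∀ p : P, TangentSpace 𝓘(ℝ, E) p →L[ℝ] TangentSpace 𝓘(ℝ, E) p) : Prop :=
  ContMDiff 𝓘(ℝ, E) (𝓘(ℝ, E).prod 𝓘(ℝ, E →L[ℝ] E)) ∞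
    (fun p : P => TotalSpace.mk' (E →L[ℝ] E)
      (E := fun p : P => TangentSpace 𝓘(ℝ, E) p →L[ℝ] TangentSpace 𝓘(ℝ, E) p) p (A p))

/-- All families of linear automorphisms of the tangent spaces. -/
abbrev FibreAut : Type _ :=
  ∀ p : P, TangentSpace 𝓘(ℝ, E) p ≃L[ℝ] TangentSpace 𝓘(ℝ, E) p

variable {E P}

theorem smoothEnd_iff (A : ∀ p : P, TangentSpace 𝓘(ℝ, E) p →L[ℝ] TangentSpace 𝓘(ℝ, E) p) :
    SmoothEnd E P A ↔ ∀ p₀ : P, ContMDiffAt 𝓘(ℝ, E) 𝓘(ℝ, E →L[ℝ] E) ∞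
      (fun p => ContinuousLinearMap.inCoordinates E (TangentSpace 𝓘(ℝ, E)) E
        (TangentSpace 𝓘(ℝ, E)) p₀ p p₀ p (A p)) p₀ := by
  unfold SmoothEnd
  constructor
  · intro h p₀
    exact ((contMDiffAt_hom_bundle _).1 (h p₀)).2
  · intro h p₀
    exact (contMDiffAt_hom_bundle _).2 ⟨contMDiffAt_id, h p₀⟩

theorem inCoordinates_mul {p₀ p : P} (hp : p ∈ (chartAt E p₀).source)
    (A B : TangentSpace 𝓘(ℝ, E) p →L[ℝ] TangentSpace 𝓘(ℝ, E) p) :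
    ContinuousLinearMap.inCoordinates E (TangentSpace 𝓘(ℝ, E)) E
        (TangentSpace 𝓘(ℝ, E)) p₀ p p₀ p (A.comp B) =
      (ContinuousLinearMap.inCoordinates E (TangentSpace 𝓘(ℝ, E)) E
        (TangentSpace 𝓘(ℝ, E)) p₀ p p₀ p A).comp
      (ContinuousLinearMap.inCoordinates E (TangentSpace 𝓘(ℝ, E)) E
        (TangentSpace 𝓘(ℝ, E)) p₀ p p₀ p B) := by
  have hb : p ∈ (trivializationAt E (TangentSpace 𝓘(ℝ, E)) p₀).baseSet := by simpa using hp
  ext v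
  rw [ContinuousLinearMap.inCoordinates_eq hb hb, ContinuousLinearMap.inCoordinates_eq hb hb,
    ContinuousLinearMap.inCoordinates_eq hb hb]
  simp
  have := Bundle.Trivialization.symm_apply_apply_mk
    (trivializationAt E (TangentSpace 𝓘(ℝ, E)) p₀) hb
    (B ((trivializationAt E (TangentSpace 𝓘(ℝ, E)) p₀).symm p v))
  rw [this]

theorem inCoordinates_one {p₀ p : P} (hp : p ∈ (chartAt E p₀).source) :
    ContinuousLinearMap.inCoordinates E (TangentSpace 𝓘(ℝ, E)) E
        (TangentSpace 𝓘(ℝ, E)) p₀ p p₀ p (ContinuousLinearMap.id ℝ (TangentSpace 𝓘(ℝ, E) p)) =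
      ContinuousLinearMap.id ℝ E := by
  have hb : p ∈ (trivializationAt E (TangentSpace 𝓘(ℝ, E)) p₀).baseSet := by simpa using hp
  ext v
  rw [ContinuousLinearMap.inCoordinates_eq hb hb]
  simp

theorem smoothEnd_one : SmoothEnd E P (fun _ => ContinuousLinearMap.id ℝ _) := by
  rw [smoothEnd_iff]
  intro p₀
  refine (contMDiffAt_const (c := ContinuousLinearMap.id ℝ E)).congr_of_eventuallyEq ?_
  filter_upwards [(chartAt E p₀).open_source.mem_nhds (mem_chart_source E p₀)] with p hp
  exact inCoordinates_one hp

theorem SmoothEnd.comp {A B : ∀ p : P, TangentSpace 𝓘(ℝ, E) p →L[ℝ] TangentSpace 𝓘(ℝ, E) p}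
    (hA : SmoothEnd E P A) (hB : SmoothEnd E P B) :
    SmoothEnd E P (fun p => (A p).comp (B p)) := by
  rw [smoothEnd_iff] at *
  intro p₀
  refine ((hA p₀).clm_comp (hB p₀)).congr_of_eventuallyEq ?_
  filter_upwards [(chartAt E p₀).open_source.mem_nhds (mem_chart_source E p₀)] with p hp
  exact inCoordinates_mul hp _ _

theorem SmoothEnd.symm [FiniteDimensional ℝ E] {A : FibreAut E P}
    (hA : SmoothEnd E P (fun p => (A p).toContinuousLinearMap)) :
    SmoothEnd E P (fun p => (A p).symm.toContinuousLinearMap) := by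
  have : CompleteSpace E := FiniteDimensional.complete ℝ E
  rw [smoothEnd_iff] at *
  intro p₀
  have key : ∀ p ∈ (chartAt E p₀).source, ∃ e : E ≃L[ℝ] E,
      (e : E →L[ℝ] E) = ContinuousLinearMap.inCoordinates E (TangentSpace 𝓘(ℝ, E)) E
        (TangentSpace 𝓘(ℝ, E)) p₀ p p₀ p (A p).toContinuousLinearMap ∧
      (e.symm : E →L[ℝ] E) = ContinuousLinearMap.inCoordinates E (TangentSpace 𝓘(ℝ, E)) E
        (TangentSpace 𝓘(ℝ, E)) p₀ p p₀ p (A p).symm.toContinuousLinearMap := by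
    intro p hp
    have h1 := inCoordinates_mul hp (A p).symm.toContinuousLinearMap (A p).toContinuousLinearMap
    have h2 := inCoordinates_mul hp (A p).toContinuousLinearMap (A p).symm.toContinuousLinearMap
    rw [ContinuousLinearEquiv.coe_symm_comp_coe, inCoordinates_one hp] at h1
    rw [ContinuousLinearEquiv.coe_comp_coe_symm, inCoordinates_one hp] at h2
    exact ⟨ContinuousLinearEquiv.equivOfInverse
      (ContinuousLinearMap.inCoordinates E (TangentSpace 𝓘(ℝ, E)) E
        (TangentSpace 𝓘(ℝ, E)) p₀ p p₀ p (A p).toContinuousLinearMap)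
      (ContinuousLinearMap.inCoordinates E (TangentSpace 𝓘(ℝ, E)) E
        (TangentSpace 𝓘(ℝ, E)) p₀ p p₀ p (A p).symm.toContinuousLinearMap)
      (fun x => (DFunLike.congr_fun h1 x).symm) (fun x => (DFunLike.congr_fun h2 x).symm),
      rfl, rfl⟩
  obtain ⟨e, he, -⟩ := key p₀ (mem_chart_source E p₀)
  have hinv : ContDiffAt ℝ ∞ (ContinuousLinearMap.inverse : (E →L[ℝ] E) → (E →L[ℝ] E))
      (ContinuousLinearMap.inCoordinates E (TangentSpace 𝓘(ℝ, E)) E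
        (TangentSpace 𝓘(ℝ, E)) p₀ p₀ p₀ p₀ (A p₀ : _ →L[ℝ] _)) := by
    rw [← he]
    exact contDiffAt_map_inverse e
  have hc := hinv.contMDiffAt.comp p₀ (hA p₀)
  refine hc.congr_of_eventuallyEq ?_
  filter_upwards [(chartAt E p₀).open_source.mem_nhds (mem_chart_source E p₀)] with p hp
  obtain ⟨e, he, he'⟩ := key p hp
  rw [Function.comp_apply, ← he, ← he', ContinuousLinearMap.inverse_equiv]

variable (E P)

/-- The group `Aut₀ TP` of smooth automorphisms of the tangent bundle covering the identity of `P`: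
families of linear isomorphisms `A(p) : T_p P → T_p P` depending smoothly on `p`; the product is
composition, `(A * A')(p) = A(p) ∘ A'(p)`. -/
def Aut₀ [FiniteDimensional ℝ E] : Subgroup (FibreAut E P) where
  carrier := {A | SmoothEnd E P (fun p => (A p).toContinuousLinearMap)}
  one_mem' := smoothEnd_one
  mul_mem' hA hB := SmoothEnd.comp hA hB
  inv_mem' hA := SmoothEnd.symm hA

/-- Differential one-forms on `T*P`, not necessarily smooth. -/
abbrev OneForm : Type _ :=
  ∀ φ : CotangentBundle E P, TangentSpace (cotModel E) φ →L[ℝ] ℝ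

/-- Vector fields on `T*P`, not necessarily smooth. -/
abbrev CotVectorField : Type _ := ∀ φ : CotangentBundle E P, TangentSpace (cotModel E) φ

variable {E P}

/-- Smoothness of a one-form on `T*P`, as a section of `T*(T*P)`. -/
def OneForm.Smooth (γ : OneForm E P) : Prop :=
  ContMDiff (cotModel E) ((cotModel E).prod 𝓘(ℝ, (E × (E →L[ℝ] ℝ)) →L[ℝ] ℝ)) ∞
    (fun φ : CotangentBundle E P => TotalSpace.mk' ((E × (E →L[ℝ] ℝ)) →L[ℝ] ℝ)
      (E := fun φ : CotangentBundle E P => TangentSpace (cotModel E) φ →L[ℝ] ℝ) φ (γ φ))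

variable (E P) in
/-- The projection `π* : T*P → P`. -/
def cotProj (φ : CotangentBundle E P) : P := φ.1

/-- The tangent map `Tπ*(φ) : T_φ(T*P) → T_{π*(φ)}P`. -/
def tProj (φ : CotangentBundle E P) :
    TangentSpace (cotModel E) φ →L[ℝ] TangentSpace 𝓘(ℝ, E) φ.1 :=
  mfderiv (cotModel E) 𝓘(ℝ, E) (cotProj E P) φ

/-- The projection `(p, φ, ψ) ↦ φ` of the fibre product `T*P ×_P T*P`. -/
def sqFst (z : CotangentBundleSq E P) : CotangentBundle E P := ⟨z.1, z.2.1⟩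

/-- The projection `(p, φ, ψ) ↦ ψ` of the fibre product `T*P ×_P T*P`. -/
def sqSnd (z : CotangentBundleSq E P) : CotangentBundle E P := ⟨z.1, z.2.2⟩

/-- Fibrewise addition `T*P ×_P T*P → T*P`. -/
def sqAdd (z : CotangentBundleSq E P) : CotangentBundle E P := ⟨z.1, z.2.1 + z.2.2⟩

/-- Fibrewise multiplication by the scalar `c` on `T*P`. -/
def cotSMul (c : ℝ) (φ : CotangentBundle E P) : CotangentBundle E P := ⟨φ.1, c • φ.2⟩

/-- `(ξ, χ)` is a linear vector field on `T*P`: `ξ` and `χ` are smooth vector fields on `T*P` and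
`P`, and `ξ : T*P → T(T*P)` is a morphism of vector bundles over `χ : P → TP`, where the vector
bundle structure of `Tπ* : T(T*P) → TP` is the prolonged one, i.e. its addition is the tangent map
of the addition `T*P ×_P T*P → T*P` (under the identification
`T(T*P ×_P T*P) = T(T*P) ×_{TP} T(T*P)` given by the tangent maps of the two projections) and its
multiplication by scalars is the tangent map of the multiplication by scalars on `T*P`. -/
structure IsLinearVectorField (ξ : CotVectorField E P)
    (χ : ∀ p : P, TangentSpace 𝓘(ℝ, E) p) : Prop where
  smooth : ContMDiff (cotModel E) (cotModel E).tangent ∞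
    (fun φ => (⟨φ, ξ φ⟩ : TangentBundle (cotModel E) (CotangentBundle E P)))
  smooth_base : ContMDiff 𝓘(ℝ, E) 𝓘(ℝ, E).tangent ∞
    (fun p => (⟨p, χ p⟩ : TangentBundle 𝓘(ℝ, E) P))
  proj : ∀ φ, tProj φ (ξ φ) = χ φ.1
  map_add : ∀ (z : CotangentBundleSq E P) (w : TangentSpace (cotSqModel E) z),
    mfderiv (cotSqModel E) (cotModel E) sqFst z w = ξ (sqFst z) →
    mfderiv (cotSqModel E) (cotModel E) sqSnd z w = ξ (sqSnd z) →
    mfderiv (cotSqModel E) (cotModel E) sqAdd z w = ξ (sqAdd z)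
  map_smul : ∀ (c : ℝ) (φ : CotangentBundle E P),
    mfderiv (cotModel E) (cotModel E) (cotSMul c) φ (ξ φ) = ξ (cotSMul c φ)

/-- Smooth fibrewise linear functions on `T*P`. -/
structure IsLinearFunction (f : CotangentBundle E P → ℝ) : Prop where
  smooth : ContMDiff (cotModel E) 𝓘(ℝ, ℝ) ∞ f
  linear : ∀ p : P, IsLinearMap ℝ
    (fun φ : TangentSpace 𝓘(ℝ, E) p →L[ℝ] ℝ => f ⟨p, φ⟩)

/-- Generalized canonical forms on `T*P`: smooth one-forms which do not vanish at any point off the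
zero section (they always vanish on the zero section), annihilate the vertical vectors, and are
fibrewise linear, i.e. send linear vector fields to fibrewise linear functions. -/
structure IsGenCanonical (γ : OneForm E P) : Prop where
  smooth : γ.Smooth
  ne_zero : ∀ φ : CotangentBundle E P, φ.2 ≠ 0 → γ φ ≠ 0
  semibasic : ∀ (φ : CotangentBundle E P) (v : TangentSpace (cotModel E) φ),
    tProj φ v = 0 → γ φ v = 0
  linear : ∀ (ξ : CotVectorField E P) (χ : ∀ p : P, TangentSpace 𝓘(ℝ, E) p),
    IsLinearVectorField ξ χ → IsLinearFunction (fun φ => γ φ (ξ φ))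

variable (E P) in
/-- The space `Can T*P` of generalized canonical forms on `T*P`. -/
def Can : Set (OneForm E P) := {γ | IsGenCanonical γ}

section

variable [FiniteDimensional ℝ E]

/-- `⟨Θ(A)_φ, ξ_φ⟩ = ⟨φ, A(π*(φ)) Tπ*(φ) ξ_φ⟩`. -/
def Θ (A : Aut₀ E P) : OneForm E P :=
  fun φ => φ.2.comp ((A.1 φ.1).toContinuousLinearMap.comp (tProj φ))

/-- The dual `A* : T*P → T*P` of `A ∈ Aut₀ TP`, given by `φ ↦ φ ∘ A(π*(φ))`. -/
def dual (A : Aut₀ E P) (φ : CotangentBundle E P) : CotangentBundle E P :=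
  ⟨φ.1, φ.2.comp (A.1 φ.1).toContinuousLinearMap⟩

/-- `L*_A(γ)` is the pull-back of `γ` along `A* : T*P → T*P`:
`⟨L*_A(γ)_φ, ξ_φ⟩ = ⟨γ_{A*(φ)}, TA*(φ) ξ_φ⟩`. -/
def Lstar (A : Aut₀ E P) (γ : OneForm E P) : OneForm E P :=
  fun φ => (γ (dual A φ)).comp (mfderiv (cotModel E) (cotModel E) (dual A) φ)

end

end GenCanForm

end

/-! A semibasic form factors pointwise as `γ φ = B φ ∘ tProj φ` with `B φ` a covector at the base
point (`exists_eq_comp_tProj`). Testing `γ` on linear vector fields with a prescribed value on `P`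
shows that `B` is linear on each fibre. Nonvanishing makes it injective, so by finite dimension it
is the transpose of an automorphism `A p` (`exists_transpose`). The matrix entries of `A` are values
of `γ` on linear fields along coordinate-constant sections, hence smooth. This gives surjectivity of
`Θ` (`IsGenCanonical.exists_Θ_eq`); it rests on a supply of linear vector fields
(`exists_isLinearVectorField`), built from constant horizontal fields in charts and bump functions
on `P`.

Since `A*` covers the identity of `P`, `Lstar_Θ` holds: through the bijection `Θ`, the action
becomes left multiplication of the group on itself, which is free and transitive. -/

noncomputable section

namespace GenCanForm

/-! ### Bundle charts of the cotangent bundle and their derivatives -/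

section Charts

theorem eventually_mem_chart {H P M : Type*} [TopologicalSpace H] [TopologicalSpace P] [ChartedSpace H P]
    [TopologicalSpace M] {f : M → P} {x : M} {p₀ : P}
    (hf : ContinuousAt f x) (hx : f x ∈ (chartAt H p₀).source) :
    ∀ᶠ y in nhds x, f y ∈ (chartAt H p₀).source :=
  hf.eventually ((chartAt H p₀).open_source.mem_nhds hx)

variable {E : Type*} [NormedAddCommGroup E] [NormedSpace ℝ E]
  {P : Type*} [TopologicalSpace P] [ChartedSpace E P] [IsManifold 𝓘(ℝ, E) ∞ P]

theorem trivializationAt_cotangent_apply {p₀ : P} {φ : CotangentBundle E P}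
    (hφ : φ.1 ∈ (chartAt E p₀).source) :
    (trivializationAt (E →L[ℝ] ℝ) (fun p : P => TangentSpace 𝓘(ℝ, E) p →L[ℝ] ℝ) p₀ φ).2 =
      φ.2.comp ((trivializationAt E (TangentSpace 𝓘(ℝ, E)) p₀).symmL ℝ φ.1) := by
  have hb : φ.1 ∈ (trivializationAt E (TangentSpace 𝓘(ℝ, E)) p₀).baseSet := by simpa using hφ
  rw [hom_trivializationAt_apply]
  dsimp only
  rw [ContinuousLinearMap.inCoordinates_eq hb (by simp)]
  ext v
  simp [Bundle.Trivialization.symmL_apply _ hb]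

theorem extChartAt_cotangent_apply {φ₀ φ : CotangentBundle E P}
    (hφ : φ.1 ∈ (chartAt E φ₀.1).source) :
    extChartAt (cotModel E) φ₀ φ = (extChartAt 𝓘(ℝ, E) φ₀.1 φ.1,
      φ.2.comp ((trivializationAt E (TangentSpace 𝓘(ℝ, E)) φ₀.1).symmL ℝ φ.1)) := by
  rw [← trivializationAt_cotangent_apply hφ]
  rfl

theorem mem_chart_source_cotangent {φ₀ φ : CotangentBundle E P} :
    φ ∈ (chartAt (ModelProd E (E →L[ℝ] ℝ)) φ₀).source ↔ φ.1 ∈ (chartAt E φ₀.1).source := by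
  simp only [FiberBundle.chartedSpace_chartAt, mfld_simps]
  refine ⟨fun h => h.1.1, fun h => ⟨⟨h, by simp⟩, ?_⟩⟩
  rwa [Bundle.Trivialization.coe_fst']
  simpa using h

theorem contMDiff_cotProj : ContMDiff (cotModel E) 𝓘(ℝ, E) ∞ (cotProj E P) :=
  contMDiff_proj _

/-- Reduces smoothness into `T*P` to maps into fixed vector spaces, where fibrewise operations are
plain linear algebra. -/
theorem contMDiffAt_cotangent_iff {EM HM M : Type*} [NormedAddCommGroup EM] [NormedSpace ℝ EM]
    [TopologicalSpace HM] {I : ModelWithCorners ℝ EM HM} [TopologicalSpace M] [ChartedSpace HM M]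
    {f : M → CotangentBundle E P} {x : M} :
    ContMDiffAt I (cotModel E) ∞ f x ↔ ContMDiffAt I 𝓘(ℝ, E) ∞ (fun y => (f y).1) x ∧
      ContMDiffAt I 𝓘(ℝ, E →L[ℝ] ℝ) ∞ (fun y => (f y).2.comp
        ((trivializationAt E (TangentSpace 𝓘(ℝ, E)) (f x).1).symmL ℝ (f y).1)) x := by
  rw [contMDiffAt_totalSpace]
  refine and_congr_right fun h => Filter.EventuallyEq.contMDiffAt_iff ?_
  filter_upwards [eventually_mem_chart h.continuousAt (mem_chart_source E (f x).1)] with y hy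
  exact trivializationAt_cotangent_apply hy

theorem contMDiff_cotSMul (c : ℝ) :
    ContMDiff (cotModel E) (cotModel E) ∞ (cotSMul c : CotangentBundle E P → _) := by
  intro φ
  have h := contMDiffAt_cotangent_iff.1 (contMDiffAt_id (I := cotModel E) (x := φ) (n := ∞))
  exact contMDiffAt_cotangent_iff.2 ⟨h.1,
    ((contMDiffAt_const (c := c) (I' := 𝓘(ℝ, ℝ))).smul h.2).congr_of_eventuallyEq
    (Filter.Eventually.of_forall fun y => ContinuousLinearMap.smul_comp _ _ _)⟩

theorem contMDiff_sqFst :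
    ContMDiff (cotSqModel E) (cotModel E) ∞ (sqFst : CotangentBundleSq E P → _) := by
  intro z
  have h := contMDiffAt_totalSpace.1 (contMDiffAt_id (I := cotSqModel E) (x := z) (n := ∞))
  have h' : ContMDiffAt (cotSqModel E) 𝓘(ℝ, E →L[ℝ] ℝ) ∞ (fun y => ((trivializationAt _
      ((fun p : P => TangentSpace 𝓘(ℝ, E) p →L[ℝ] ℝ) ×ᵇ
        (fun p : P => TangentSpace 𝓘(ℝ, E) p →L[ℝ] ℝ)) z.1 y).2).fst) z :=
    (ContinuousLinearMap.fst ℝ (E →L[ℝ] ℝ) (E →L[ℝ] ℝ)).contDiff.contMDiff.contMDiffAt.comp z h.2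
  exact contMDiffAt_totalSpace.2 ⟨h.1, h'⟩

theorem contMDiff_sqSnd :
    ContMDiff (cotSqModel E) (cotModel E) ∞ (sqSnd : CotangentBundleSq E P → _) := by
  intro z
  have h := contMDiffAt_totalSpace.1 (contMDiffAt_id (I := cotSqModel E) (x := z) (n := ∞))
  have h' : ContMDiffAt (cotSqModel E) 𝓘(ℝ, E →L[ℝ] ℝ) ∞ (fun y => ((trivializationAt _
      ((fun p : P => TangentSpace 𝓘(ℝ, E) p →L[ℝ] ℝ) ×ᵇ
        (fun p : P => TangentSpace 𝓘(ℝ, E) p →L[ℝ] ℝ)) z.1 y).2).snd) z :=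
    (ContinuousLinearMap.snd ℝ (E →L[ℝ] ℝ) (E →L[ℝ] ℝ)).contDiff.contMDiff.contMDiffAt.comp z h.2
  exact contMDiffAt_totalSpace.2 ⟨h.1, h'⟩

theorem contMDiff_sqAdd :
    ContMDiff (cotSqModel E) (cotModel E) ∞ (sqAdd : CotangentBundleSq E P → _) := by
  intro z
  have h₁ := contMDiffAt_cotangent_iff.1 (contMDiff_sqFst z)
  have h₂ := contMDiffAt_cotangent_iff.1 (contMDiff_sqSnd z)
  exact contMDiffAt_cotangent_iff.2 ⟨h₁.1, (h₁.2.add h₂.2).congr_of_eventuallyEq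
    (Filter.Eventually.of_forall fun y => ContinuousLinearMap.add_comp _ _ _)⟩

/-- The tangent map at `φ` of the chart of `T*P` centred at `φ₀`. -/
def chartDeriv (φ₀ φ : CotangentBundle E P) :
    TangentSpace (cotModel E) φ →L[ℝ] E × (E →L[ℝ] ℝ) :=
  mfderiv (cotModel E) 𝓘(ℝ, E × (E →L[ℝ] ℝ)) (extChartAt (cotModel E) φ₀) φ

theorem chartDeriv_injective {φ₀ φ : CotangentBundle E P}
    (hφ : φ.1 ∈ (chartAt E φ₀.1).source) : Function.Injective (chartDeriv φ₀ φ) := by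
  have h : φ ∈ (extChartAt (cotModel E) φ₀).source := by
    rw [extChartAt_source]; exact mem_chart_source_cotangent.2 hφ
  exact (isInvertible_mfderiv_extChartAt h).injective

theorem chartDeriv_symm {φ₀ φ : CotangentBundle E P} (hφ : φ.1 ∈ (chartAt E φ₀.1).source)
    (u : E × (E →L[ℝ] ℝ)) : chartDeriv φ₀ φ
      ((trivializationAt (E × (E →L[ℝ] ℝ)) (TangentSpace (cotModel E)) φ₀).symmL ℝ φ u) = u := by
  have h := mem_chart_source_cotangent.2 hφ
  have hb : φ ∈ (trivializationAt (E × (E →L[ℝ] ℝ)) (TangentSpace (cotModel E)) φ₀).baseSet := by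
    simpa using h
  have := IsManifold.of_le (I := cotModel E) (M := CotangentBundle E P) (m := 1) (n := ∞) (by simp)
  rw [chartDeriv, ← TangentBundle.continuousLinearMapAt_trivializationAt h]
  exact Bundle.Trivialization.continuousLinearMapAt_symmL _ hb u

theorem chartDeriv_comp {EM HM M : Type*} [NormedAddCommGroup EM] [NormedSpace ℝ EM]
    [TopologicalSpace HM] {I : ModelWithCorners ℝ EM HM} [TopologicalSpace M] [ChartedSpace HM M]
    {f : M → CotangentBundle E P} {x : M} (hf : MDifferentiableAt I (cotModel E) f x)
    {φ₀ : CotangentBundle E P} (hx : (f x).1 ∈ (chartAt E φ₀.1).source) :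
    HasMFDerivAt I 𝓘(ℝ, E × (E →L[ℝ] ℝ)) (fun y => extChartAt (cotModel E) φ₀ (f y)) x
      ((chartDeriv φ₀ (f x)).comp (mfderiv I (cotModel E) f x)) := by
  have := IsManifold.of_le (I := cotModel E) (M := CotangentBundle E P) (m := 1) (n := ∞) (by simp)
  have h := (mdifferentiableAt_extChartAt (I := cotModel E)
    (mem_chart_source_cotangent.2 hx)).hasMFDerivAt
  exact h.comp x hf.hasMFDerivAt

/-- The chart is linear on fibres, so in it the map is `(x, y) ↦ (x, c • y)`, which is its own
derivative. -/
theorem chartDeriv_cotSMul {φ₀ φ : CotangentBundle E P} (hφ : φ.1 ∈ (chartAt E φ₀.1).source)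
    (c : ℝ) (w : TangentSpace (cotModel E) φ) :
    chartDeriv φ₀ (cotSMul c φ) (mfderiv (cotModel E) (cotModel E) (cotSMul c) φ w) =
      ((chartDeriv φ₀ φ w).1, c • (chartDeriv φ₀ φ w).2) := by
  have h₁ := chartDeriv_comp ((contMDiff_cotSMul c).mdifferentiable (by simp) φ) (φ₀ := φ₀) hφ
  have h₂ := chartDeriv_comp (mdifferentiableAt_id (I := cotModel E) (x := φ)) (φ₀ := φ₀) hφ
  have h₃ := (((ContinuousLinearMap.fst ℝ E (E →L[ℝ] ℝ)).prod
    (c • ContinuousLinearMap.snd ℝ E (E →L[ℝ] ℝ))).hasMFDerivAt).comp φ h₂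
  have h₄ := h₃.congr_of_eventuallyEq (f₁ := fun ψ => extChartAt (cotModel E) φ₀ (cotSMul c ψ)) <| by
    filter_upwards [eventually_mem_chart (contMDiff_cotProj φ).continuousAt hφ] with ψ hψ
    have hψ' : ψ.1 ∈ (chartAt E φ₀.1).source := hψ
    have hψ'' : (cotSMul c ψ).1 ∈ (chartAt E φ₀.1).source := hψ
    rw [extChartAt_cotangent_apply hψ'']
    simp only [Function.comp_apply, id]
    rw [extChartAt_cotangent_apply hψ']
    rfl
  have h := DFunLike.congr_fun (hasMFDerivAt_unique h₁ h₄) w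
  rw [mfderiv_id] at h
  exact h

theorem chartDeriv_sqAdd {φ₀ : CotangentBundle E P} {z : CotangentBundleSq E P}
    (hz : z.1 ∈ (chartAt E φ₀.1).source) (w : TangentSpace (cotSqModel E) z) :
    chartDeriv φ₀ (sqAdd z) (mfderiv (cotSqModel E) (cotModel E) sqAdd z w) =
      ((chartDeriv φ₀ (sqFst z) (mfderiv (cotSqModel E) (cotModel E) sqFst z w)).1,
        (chartDeriv φ₀ (sqFst z) (mfderiv (cotSqModel E) (cotModel E) sqFst z w)).2 +
        (chartDeriv φ₀ (sqSnd z) (mfderiv (cotSqModel E) (cotModel E) sqSnd z w)).2) := by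
  have h₀ := chartDeriv_comp (contMDiff_sqAdd.mdifferentiable (by simp) z) (φ₀ := φ₀) hz
  have h₁ := chartDeriv_comp (contMDiff_sqFst.mdifferentiable (by simp) z) (φ₀ := φ₀) hz
  have h₂ := chartDeriv_comp (contMDiff_sqSnd.mdifferentiable (by simp) z) (φ₀ := φ₀) hz
  -- In the chart, addition is `(x, y) + (0, y')`: both summands share the base point, so its
  -- coordinate is taken from the first only.
  have h₃ := (((ContinuousLinearMap.fst ℝ E (E →L[ℝ] ℝ)).prod
    (ContinuousLinearMap.snd ℝ E (E →L[ℝ] ℝ))).hasMFDerivAt.comp z h₁).add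
    (((0 : (E × (E →L[ℝ] ℝ)) →L[ℝ] E).prod
    (ContinuousLinearMap.snd ℝ E (E →L[ℝ] ℝ))).hasMFDerivAt.comp z h₂)
  have h₄ := h₃.congr_of_eventuallyEq (f₁ := fun y => extChartAt (cotModel E) φ₀ (sqAdd y)) <| by
    filter_upwards [eventually_mem_chart
      (contMDiff_cotProj.comp contMDiff_sqFst z).continuousAt hz] with y hy
    have h₀ : (sqAdd y).1 ∈ (chartAt E φ₀.1).source := hy
    have h₁ : (sqFst y).1 ∈ (chartAt E φ₀.1).source := hy
    have h₂ : (sqSnd y).1 ∈ (chartAt E φ₀.1).source := hy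
    rw [extChartAt_cotangent_apply h₀]
    simp only [Function.comp_apply, Pi.add_apply]
    rw [extChartAt_cotangent_apply h₁, extChartAt_cotangent_apply h₂]
    ext v
    · simp; rfl
    · simp; rfl
  have h := DFunLike.congr_fun (hasMFDerivAt_unique h₀ h₄) w
  refine h.trans ?_
  refine Prod.ext ?_ ?_
  · exact add_zero _
  · rfl

theorem mfderiv_extChartAt_tProj {φ₀ φ : CotangentBundle E P}
    (hφ : φ.1 ∈ (chartAt E φ₀.1).source) (w : TangentSpace (cotModel E) φ) :
    mfderiv 𝓘(ℝ, E) 𝓘(ℝ, E) (extChartAt 𝓘(ℝ, E) φ₀.1) φ.1 (tProj φ w) =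
      (chartDeriv φ₀ φ w).1 := by
  have := IsManifold.of_le (I := 𝓘(ℝ, E)) (M := P) (m := 1) (n := ∞) (by simp)
  have h₁ := (mdifferentiableAt_extChartAt (I := 𝓘(ℝ, E)) hφ).hasMFDerivAt.comp φ
    ((contMDiff_cotProj (E := E)).mdifferentiable (by simp) φ).hasMFDerivAt
  have h₂ := (ContinuousLinearMap.fst ℝ E (E →L[ℝ] ℝ)).hasMFDerivAt.comp φ
    (chartDeriv_comp (mdifferentiableAt_id (I := cotModel E) (x := φ)) (φ₀ := φ₀) hφ)
  have h₄ := h₂.congr_of_eventuallyEq (f₁ := extChartAt 𝓘(ℝ, E) φ₀.1 ∘ cotProj E P) <| by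
    filter_upwards [eventually_mem_chart (contMDiff_cotProj φ).continuousAt hφ] with ψ hψ
    have hψ' : ψ.1 ∈ (chartAt E φ₀.1).source := hψ
    simp only [Function.comp_apply, id]
    rw [extChartAt_cotangent_apply hψ']
    rfl
  have h := DFunLike.congr_fun (hasMFDerivAt_unique h₁ h₄) w
  rw [mfderiv_id] at h
  exact h

end Charts

/-! ### Construction of linear vector fields; semibasic forms -/

section LinearVectorFields

variable {E : Type*} [NormedAddCommGroup E] [NormedSpace ℝ E]
  {P : Type*} [TopologicalSpace P] [ChartedSpace E P] [IsManifold 𝓘(ℝ, E) ∞ P]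

/-- The local vector field on `P` which is constantly `v` in the chart at `p₀`. -/
def chartField (p₀ : P) (v : E) (p : P) : TangentSpace 𝓘(ℝ, E) p :=
  (trivializationAt E (TangentSpace 𝓘(ℝ, E)) p₀).symmL ℝ p v

/-- The local vector field on `T*P` which is constantly `u` in the chart at `φ₀`. -/
def cotChartField (φ₀ : CotangentBundle E P) (u : E × (E →L[ℝ] ℝ)) : CotVectorField E P :=
  fun φ => (trivializationAt (E × (E →L[ℝ] ℝ)) (TangentSpace (cotModel E)) φ₀).symmL ℝ φ u

theorem contMDiffOn_chartField (p₀ : P) (v : E) :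
    ContMDiffOn 𝓘(ℝ, E) 𝓘(ℝ, E).tangent ∞
      (fun p => (⟨p, chartField p₀ v p⟩ : TangentBundle 𝓘(ℝ, E) P)) (chartAt E p₀).source := by
  have h := (Bundle.Trivialization.contMDiffOn_section_baseSet_iff (IB := 𝓘(ℝ, E)) (n := ∞)
    (trivializationAt E (TangentSpace 𝓘(ℝ, E)) p₀) (s := chartField p₀ v)).2 <| by
      refine (contMDiffOn_const (c := v)).congr fun p hp => ?_
      rw [chartField, Bundle.Trivialization.symmL_apply _ hp,
        Bundle.Trivialization.apply_mk_symm _ hp]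
  simpa using h

theorem contMDiffOn_cotChartField (φ₀ : CotangentBundle E P) (u : E × (E →L[ℝ] ℝ)) :
    ContMDiffOn (cotModel E) (cotModel E).tangent ∞
      (fun φ => (⟨φ, cotChartField φ₀ u φ⟩ : TangentBundle (cotModel E) (CotangentBundle E P)))
      (chartAt (ModelProd E (E →L[ℝ] ℝ)) φ₀).source := by
  have h := (Bundle.Trivialization.contMDiffOn_section_baseSet_iff (IB := cotModel E) (n := ∞)
    (trivializationAt (E × (E →L[ℝ] ℝ)) (TangentSpace (cotModel E)) φ₀)
    (s := cotChartField φ₀ u)).2 <| by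
      refine (contMDiffOn_const (c := u)).congr fun p hp => ?_
      rw [cotChartField, Bundle.Trivialization.symmL_apply _ hp,
        Bundle.Trivialization.apply_mk_symm _ hp]
  simpa using h

/-- In charts `π*` is the first projection, so chart-constant fields project to chart-constant
fields. -/
theorem tProj_symmL {φ₀ φ : CotangentBundle E P} (hφ : φ.1 ∈ (chartAt E φ₀.1).source)
    (u : E × (E →L[ℝ] ℝ)) :
    tProj φ ((trivializationAt (E × (E →L[ℝ] ℝ)) (TangentSpace (cotModel E)) φ₀).symmL ℝ φ u) =
      (trivializationAt E (TangentSpace 𝓘(ℝ, E)) φ₀.1).symmL ℝ φ.1 u.1 := by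
  have := IsManifold.of_le (I := 𝓘(ℝ, E)) (M := P) (m := 1) (n := ∞) (by simp)
  have hs : φ.1 ∈ (extChartAt 𝓘(ℝ, E) φ₀.1).source := by rwa [extChartAt_source]
  have hb : φ.1 ∈ (trivializationAt E (TangentSpace 𝓘(ℝ, E)) φ₀.1).baseSet := by simpa using hφ
  apply (isInvertible_mfderiv_extChartAt hs).injective
  rw [mfderiv_extChartAt_tProj hφ, chartDeriv_symm hφ,
    ← TangentBundle.continuousLinearMapAt_trivializationAt hφ]
  exact (Bundle.Trivialization.continuousLinearMapAt_symmL _ hb u.1).symm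

theorem tProj_surjective (φ : CotangentBundle E P) : Function.Surjective (tProj φ) := by
  intro v
  refine ⟨(trivializationAt (E × (E →L[ℝ] ℝ)) (TangentSpace (cotModel E)) φ).symmL ℝ φ
    ((trivializationAt E (TangentSpace 𝓘(ℝ, E)) φ.1).continuousLinearMapAt ℝ φ.1 v, 0), ?_⟩
  rw [tProj_symmL (mem_chart_source E φ.1)]
  exact Bundle.Trivialization.symmL_continuousLinearMapAt _
    (FiberBundle.mem_baseSet_trivializationAt' φ.1) v

theorem chartDeriv_smul_cotChartField {φ₀ φ : CotangentBundle E P}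
    (hφ : φ.1 ∈ (chartAt E φ₀.1).source) (c : ℝ) (u : E × (E →L[ℝ] ℝ)) :
    chartDeriv φ₀ φ (c • cotChartField φ₀ u φ) = c • u := by
  rw [(chartDeriv φ₀ φ).map_smul, cotChartField, chartDeriv_symm hφ]

/-- A vector field which is constant and horizontal in a chart of `T*P`, cut off by a function on
`P` supported in the domain of the chart, is linear. -/
theorem isLinearVectorField_smul_cotChartField (p₀ : P) (v : E) {f : P → ℝ}
    (hf : ContMDiff 𝓘(ℝ, E) 𝓘(ℝ, ℝ) ∞ f) (hsupp : tsupport f ⊆ (chartAt E p₀).source) :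
    IsLinearVectorField (E := E) (P := P)
      (fun φ => f φ.1 • cotChartField ⟨p₀, 0⟩ (v, 0) φ) (fun p => f p • chartField p₀ v p) := by
  have hzero : ∀ p ∉ (chartAt E p₀).source, f p = 0 := fun p hp =>
    image_eq_zero_of_notMem_tsupport fun h => hp (hsupp h)
  set φ₀ : CotangentBundle E P := ⟨p₀, 0⟩
  refine ⟨?_, ?_, fun φ => ?_, fun z w h₁ h₂ => ?_, fun c φ => ?_⟩
  · refine ContMDiffOn.smul_section_of_tsupport (ψ := f ∘ cotProj E P)
      (hf.comp contMDiff_cotProj).contMDiffOn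
      (chartAt (ModelProd E (E →L[ℝ] ℝ)) φ₀).open_source ?_ (contMDiffOn_cotChartField φ₀ (v, 0))
    -- A chart domain of `T*P` is a union of whole fibres, so a cutoff on the base suffices.
    intro φ hφ
    exact mem_chart_source_cotangent.2
      (hsupp (tsupport_comp_subset_preimage f contMDiff_cotProj.continuous hφ))
  · exact ContMDiffOn.smul_section_of_tsupport hf.contMDiffOn (chartAt E p₀).open_source hsupp
      (contMDiffOn_chartField p₀ v)
  · by_cases h : φ.1 ∈ (chartAt E p₀).source
    · rw [(tProj φ).map_smul, cotChartField, tProj_symmL h]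
      rfl
    · rw [hzero _ h, zero_smul, zero_smul, (tProj φ).map_zero]
  · by_cases h : z.1 ∈ (chartAt E p₀).source
    · refine chartDeriv_injective (φ₀ := φ₀) (φ := sqAdd z) h ?_
      rw [chartDeriv_sqAdd h, h₁, h₂, chartDeriv_smul_cotChartField (φ := sqFst z) h,
        chartDeriv_smul_cotChartField (φ := sqSnd z) h,
        chartDeriv_smul_cotChartField (φ := sqAdd z) h]
      simp [sqFst, sqAdd]
    · have h₀ : z.1 ∈ (chartAt E (sqFst z).1).source := mem_chart_source E z.1
      have hf₁ : f (sqFst z).1 = 0 := hzero _ h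
      have hf₂ : f (sqSnd z).1 = 0 := hzero _ h
      have hf₃ : f (sqAdd z).1 = 0 := hzero _ h
      -- Off the chart domain at `p₀` the cutoff kills the field; a chart around the point itself is
      -- used to see that the tangent map of addition sends zero components to zero.
      refine chartDeriv_injective (φ₀ := sqFst z) (φ := sqAdd z) h₀ ?_
      rw [chartDeriv_sqAdd h₀, h₁, h₂, hf₁, hf₂, hf₃, zero_smul, zero_smul, zero_smul,
        ContinuousLinearMap.map_zero, ContinuousLinearMap.map_zero, ContinuousLinearMap.map_zero]
      simp
  · by_cases h : φ.1 ∈ (chartAt E p₀).source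
    · refine chartDeriv_injective (φ₀ := φ₀) (φ := cotSMul c φ) h ?_
      rw [chartDeriv_cotSMul h, chartDeriv_smul_cotChartField h,
        chartDeriv_smul_cotChartField (φ := cotSMul c φ) h]
      simp [cotSMul]
    · have hf₁ : f (cotSMul c φ).1 = 0 := hzero _ h
      rw [hzero _ h, hf₁, zero_smul, zero_smul, ContinuousLinearMap.map_zero]

/-- A bump function at `p₀` serves as cutoff. Hausdorffness is what makes its extension by zero
smooth on all of `P`. -/
theorem exists_isLinearVectorField [FiniteDimensional ℝ E] [T2Space P] (p₀ : P) (v : E) :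
    ∃ (ξ : CotVectorField E P) (χ : ∀ p : P, TangentSpace 𝓘(ℝ, E) p),
      IsLinearVectorField ξ χ ∧ ∀ᶠ p in nhds p₀, χ p = chartField p₀ v p := by
  obtain ⟨f⟩ : Nonempty (SmoothBumpFunction 𝓘(ℝ, E) p₀) := inferInstance
  refine ⟨_, _, isLinearVectorField_smul_cotChartField p₀ v f.contMDiff
    f.tsupport_subset_chartAt_source, ?_⟩
  filter_upwards [f.eventuallyEq_one] with p hp
  simp [hp]

theorem smooth_iff_comp_symmL (γ : OneForm E P) :
    γ.Smooth ↔ ∀ φ₀, ContMDiffAt (cotModel E) 𝓘(ℝ, (E × (E →L[ℝ] ℝ)) →L[ℝ] ℝ) ∞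
      (fun φ => (γ φ).comp ((trivializationAt (E × (E →L[ℝ] ℝ))
        (TangentSpace (cotModel E)) φ₀).symmL ℝ φ)) φ₀ := by
  refine forall_congr' fun φ₀ => ?_
  rw [contMDiffAt_hom_bundle]
  refine (and_iff_right contMDiffAt_id).trans (Filter.EventuallyEq.contMDiffAt_iff ?_)
  refine Filter.Eventually.of_forall fun φ => ?_
  refine ContinuousLinearMap.ext fun u => ?_
  simp [ContinuousLinearMap.inCoordinates]

theorem OneForm.Smooth.contMDiff_apply {γ : OneForm E P} (hγ : γ.Smooth) {ξ : CotVectorField E P}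
    (hξ : ContMDiff (cotModel E) (cotModel E).tangent ∞
      (fun φ => (⟨φ, ξ φ⟩ : TangentBundle (cotModel E) (CotangentBundle E P)))) :
    ContMDiff (cotModel E) 𝓘(ℝ, ℝ) ∞ (fun φ => γ φ (ξ φ)) := fun φ =>
  (contMDiffAt_totalSpace.1 (ContMDiffAt.clm_bundle_apply
    (E₂ := Bundle.Trivial (CotangentBundle E P) ℝ) (F₂ := ℝ) (hγ φ) (hξ φ))).2

/-- A one-form which annihilates the vertical vectors is the pull-back of a covector of `P` at
each point. -/
theorem exists_eq_comp_tProj {γ : OneForm E P}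
    (hγ : ∀ (φ : CotangentBundle E P) (v : TangentSpace (cotModel E) φ), tProj φ v = 0 → γ φ v = 0) :
    ∃ B : ∀ φ : CotangentBundle E P, TangentSpace 𝓘(ℝ, E) φ.1 →L[ℝ] ℝ,
      ∀ φ w, γ φ w = B φ (tProj φ w) := by
  -- `B φ` evaluates `γ φ` on the horizontal lift in the chart at `φ`; any other lift differs by a
  -- vertical vector.
  refine ⟨fun φ => (γ φ).comp
    (((trivializationAt (E × (E →L[ℝ] ℝ)) (TangentSpace (cotModel E)) φ).symmL ℝ φ).comp
    ((ContinuousLinearMap.inl ℝ E (E →L[ℝ] ℝ)).comp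
    ((trivializationAt E (TangentSpace 𝓘(ℝ, E)) φ.1).continuousLinearMapAt ℝ φ.1))), fun φ w => ?_⟩
  have h : ∀ v w, tProj φ v = tProj φ w → γ φ v = γ φ w := fun v w h =>
    sub_eq_zero.1 <| ((γ φ).map_sub v w).symm.trans <| hγ φ _ <|
      ((tProj φ).map_sub v w).trans (sub_eq_zero.2 h)
  refine h _ _ (Eq.symm ?_)
  refine (tProj_symmL (mem_chart_source E φ.1) _).trans ?_
  exact Bundle.Trivialization.symmL_continuousLinearMapAt _
    (FiberBundle.mem_baseSet_trivializationAt' φ.1) (tProj φ w)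

/-- Pulling a smooth function on `T*P` back along this section gives a function smooth at `p₀`; this
is how matrix entries are read off. -/
theorem contMDiffAt_constant_section (p₀ : P) (ψ : E →L[ℝ] ℝ) :
    ContMDiffAt 𝓘(ℝ, E) (cotModel E) ∞ (fun p => (⟨p, ψ.comp
      ((trivializationAt E (TangentSpace 𝓘(ℝ, E)) p₀).continuousLinearMapAt ℝ p)⟩ :
        CotangentBundle E P)) p₀ := by
  refine contMDiffAt_cotangent_iff.2 ⟨contMDiffAt_id, ?_⟩
  refine (contMDiffAt_const (c := ψ)).congr_of_eventuallyEq ?_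
  filter_upwards [(chartAt E p₀).open_source.mem_nhds (mem_chart_source E p₀)] with p hp
  have hb : p ∈ (trivializationAt E (TangentSpace 𝓘(ℝ, E)) p₀).baseSet := by simpa using hp
  ext v
  exact congrArg ψ (Bundle.Trivialization.continuousLinearMapAt_symmL (R := ℝ)
    (trivializationAt E (TangentSpace 𝓘(ℝ, E)) p₀) hb v)

end LinearVectorFields

/-! ### Properties of `Θ` and the effect of the action on it -/

section Theta

variable {E : Type*} [NormedAddCommGroup E] [NormedSpace ℝ E] [FiniteDimensional ℝ E]
  {P : Type*} [TopologicalSpace P] [ChartedSpace E P] [IsManifold 𝓘(ℝ, E) ∞ P]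

theorem contMDiff_dual (A : Aut₀ E P) : ContMDiff (cotModel E) (cotModel E) ∞ (dual A) := by
  intro φ
  have h := contMDiffAt_cotangent_iff.1 (contMDiffAt_id (I := cotModel E) (x := φ) (n := ∞))
  have hA := ((smoothEnd_iff _).1 A.2 φ.1).comp φ (contMDiff_cotProj φ)
  refine contMDiffAt_cotangent_iff.2 ⟨h.1, (h.2.clm_comp hA).congr_of_eventuallyEq ?_⟩
  filter_upwards [eventually_mem_chart (contMDiff_cotProj φ).continuousAt
    (mem_chart_source E φ.1)] with ψ hψ
  have hb : ψ.1 ∈ (trivializationAt E (TangentSpace 𝓘(ℝ, E)) φ.1).baseSet := by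
    rw [TangentBundle.trivializationAt_baseSet]; exact hψ
  ext v
  exact (congrArg ψ.2 (Bundle.Trivialization.symmL_continuousLinearMapAt (R := ℝ)
    (trivializationAt E (TangentSpace 𝓘(ℝ, E)) φ.1) hb _)).symm

theorem smooth_Θ (A : Aut₀ E P) : (Θ A).Smooth := by
  refine (smooth_iff_comp_symmL _).2 fun φ₀ => ?_
  -- The coordinates of `Θ A` at `φ` are the fibre coordinate of `A*(φ)` precomposed with the first
  -- projection, so smoothness of `A*` is enough.
  have h := (contMDiffAt_cotangent_iff.1 (contMDiff_dual A φ₀)).2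
  refine (h.clm_comp (contMDiffAt_const
    (c := ContinuousLinearMap.fst ℝ E (E →L[ℝ] ℝ)))).congr_of_eventuallyEq ?_
  filter_upwards [eventually_mem_chart (contMDiff_cotProj φ₀).continuousAt
    (mem_chart_source E φ₀.1)] with φ hφ
  refine ContinuousLinearMap.ext fun u => ?_
  exact congrArg (fun x => φ.2 (A.1 φ.1 x)) (tProj_symmL (φ₀ := φ₀) hφ u)

theorem isGenCanonical_Θ (A : Aut₀ E P) : IsGenCanonical (Θ A) where
  smooth := smooth_Θ A
  ne_zero φ hφ h := hφ <| by
    ext v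
    obtain ⟨w, hw⟩ := tProj_surjective φ ((A.1 φ.1).symm v)
    have h' : φ.2 (A.1 φ.1 (tProj φ w)) = 0 := DFunLike.congr_fun h w
    rwa [hw, ContinuousLinearEquiv.apply_symm_apply] at h'
  semibasic φ v hv := by
    change φ.2 (A.1 φ.1 (tProj φ v)) = 0
    rw [hv, map_zero, map_zero]
  linear ξ χ h := by
    refine ⟨(smooth_Θ A).contMDiff_apply h.smooth, fun p => ?_⟩
    have : (fun φ : TangentSpace 𝓘(ℝ, E) p →L[ℝ] ℝ => Θ A ⟨p, φ⟩ (ξ ⟨p, φ⟩)) =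
        fun φ => φ (A.1 p (χ p)) :=
      funext fun φ => congrArg (fun x => φ (A.1 p x)) (h.proj ⟨p, φ⟩)
    rw [this]
    exact ⟨fun _ _ => rfl, fun _ _ => rfl⟩

/-- Every tangent vector of `P` lifts to `T*P`, and covectors separate tangent vectors. -/
theorem Θ_injective : Function.Injective (Θ : Aut₀ E P → OneForm E P) := by
  intro A B h
  refine Subtype.ext (funext fun p => ContinuousLinearEquiv.ext (funext fun v => ?_))
  refine (SeparatingDual.eq_iff_forall_dual_eq (R := ℝ) (V := E)).2 fun ψ => ?_
  obtain ⟨w, hw⟩ := tProj_surjective (⟨p, ψ⟩ : CotangentBundle E P) v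
  have h' : ψ (A.1 p (tProj (⟨p, ψ⟩ : CotangentBundle E P) w)) =
      ψ (B.1 p (tProj (⟨p, ψ⟩ : CotangentBundle E P) w)) :=
    DFunLike.congr_fun (congrFun h ⟨p, ψ⟩) w
  rwa [hw] at h'

/-- Chain rule applied to `π* ∘ A* = π*`. -/
theorem tProj_comp_mfderiv_dual (A : Aut₀ E P) (φ : CotangentBundle E P) :
    (tProj (dual A φ)).comp (mfderiv (cotModel E) (cotModel E) (dual A) φ) = tProj φ :=
  (mfderiv_comp φ (contMDiff_cotProj.mdifferentiable (by simp) (dual A φ))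
    ((contMDiff_dual A).mdifferentiable (by simp) φ)).symm

theorem Lstar_Θ (A A' : Aut₀ E P) : Lstar A (Θ A') = Θ (A * A') := by
  funext φ
  ext w
  exact congrArg (fun x => φ.2 (A.1 φ.1 (A'.1 φ.1 x)))
    (DFunLike.congr_fun (tProj_comp_mfderiv_dual A φ) w)

end Theta

/-! ### Finite-dimensional duality -/

section FiniteDimensional

variable {V : Type*} [NormedAddCommGroup V] [NormedSpace ℝ V] [FiniteDimensional ℝ V]

theorem sum_smul_finBasis_coord (φ : V →L[ℝ] ℝ) :
    ∑ i, φ (Module.finBasis ℝ V i) • LinearMap.toContinuousLinearMap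
      ((Module.finBasis ℝ V).coord i) = φ := by
  ext v
  conv_rhs => rw [← (Module.finBasis ℝ V).sum_repr v, map_sum]
  simp [mul_comm]

/-- An injective linear endomorphism of the dual of a finite-dimensional space is the transpose of
an automorphism. -/
theorem exists_transpose {β : (V →L[ℝ] ℝ) → (V →L[ℝ] ℝ)}
    (hβ : ∀ v, IsLinearMap ℝ fun φ => β φ v) (hinj : ∀ φ, β φ = 0 → φ = 0) :
    ∃ A : V ≃L[ℝ] V, ∀ φ v, β φ v = φ (A v) := by
  let L : (V →L[ℝ] ℝ) →ₗ[ℝ] (V →L[ℝ] ℝ) :=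
    { toFun := β
      map_add' := fun φ ψ => ContinuousLinearMap.ext fun v => (hβ v).1 φ ψ
      map_smul' := fun c φ => ContinuousLinearMap.ext fun v => (hβ v).2 c φ }
  have hL : Function.Injective L := (injective_iff_map_eq_zero L).2 hinj
  let c : Fin (Module.finrank ℝ V) → V →L[ℝ] ℝ := fun i =>
    LinearMap.toContinuousLinearMap ((Module.finBasis ℝ V).coord i)
  -- Chosen so that the `i`-th coordinate of `A v` is `L (c i) v`.
  let A : V →ₗ[ℝ] V :=
    ∑ i, (L (c i) : V →ₗ[ℝ] ℝ).smulRight (Module.finBasis ℝ V i)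
  have hA : ∀ φ v, β φ v = φ (A v) := by
    intro φ v
    have h : L φ = ∑ i, φ (Module.finBasis ℝ V i) • L (c i) := by
      conv_lhs => rw [← sum_smul_finBasis_coord φ]
      simp [c, map_sum]
    change L φ v = φ (A v)
    rw [h]
    simp [A, map_sum, mul_comm]
  have hAinj : Function.Injective A := by
    refine (injective_iff_map_eq_zero A).2 fun v hv =>
      SeparatingDual.eq_zero_of_forall_dual_eq_zero (R := ℝ) fun ψ => ?_
    -- In finite dimension `L` is onto, so every covector has the form `φ ∘ A` and kills `v`.
    obtain ⟨φ, rfl⟩ := LinearMap.surjective_of_injective hL ψ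
    exact (hA φ v).trans (by rw [hv, map_zero])
  exact ⟨(LinearEquiv.ofInjectiveEndo A hAinj).toContinuousLinearEquiv, hA⟩

/-- Expanding in a basis writes `F` as a finite sum of its matrix entries times constant rank-one
maps. -/
theorem contMDiffAt_clm_of_dual_apply {EM HM M : Type*} [NormedAddCommGroup EM] [NormedSpace ℝ EM]
    [TopologicalSpace HM] {I : ModelWithCorners ℝ EM HM} [TopologicalSpace M] [ChartedSpace HM M]
    {F : M → V →L[ℝ] V} {x : M}
    (h : ∀ (ψ : V →L[ℝ] ℝ) (v : V), ContMDiffAt I 𝓘(ℝ, ℝ) ∞ (fun y => ψ (F y v)) x) :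
    ContMDiffAt I 𝓘(ℝ, V →L[ℝ] V) ∞ F x := by
  let b := Module.finBasis ℝ V
  let c : Fin (Module.finrank ℝ V) → V →L[ℝ] ℝ := fun i =>
    LinearMap.toContinuousLinearMap (b.coord i)
  have hF : F = fun y => ∑ i, ∑ j, c i (F y (b j)) • (c j).smulRight (b i) := by
    funext y
    refine ContinuousLinearMap.coe_injective (b.ext fun k => ?_)
    simp only [ContinuousLinearMap.coe_coe, _root_.sum_apply,
      _root_.smul_apply, ContinuousLinearMap.smulRight_apply]
    conv_lhs => rw [← b.sum_repr (F y (b k))]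
    refine Finset.sum_congr rfl fun i _ => ?_
    rw [Finset.sum_eq_single k]
    · simp [c]
    · intro j _ hj
      simp [c, Finsupp.single_eq_of_ne hj]
    · simp
  rw [hF]
  exact ContMDiffAt.sum fun i _ => ContMDiffAt.sum fun j _ =>
    (h (c i) (b j)).smul contMDiffAt_const

end FiniteDimensional

/-! ### Every generalized canonical form comes from an automorphism -/

section Surjectivity

variable {E : Type*} [NormedAddCommGroup E] [NormedSpace ℝ E] [FiniteDimensional ℝ E]
  {P : Type*} [TopologicalSpace P] [T2Space P] [ChartedSpace E P] [IsManifold 𝓘(ℝ, E) ∞ P]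

theorem IsGenCanonical.exists_Θ_eq {γ : OneForm E P} (hγ : IsGenCanonical γ) :
    ∃ A : Aut₀ E P, Θ A = γ := by
  obtain ⟨B, hB⟩ := exists_eq_comp_tProj hγ.semibasic
  have hlin : ∀ (p : P) (v : TangentSpace 𝓘(ℝ, E) p), IsLinearMap ℝ
      fun φ : TangentSpace 𝓘(ℝ, E) p →L[ℝ] ℝ => B ⟨p, φ⟩ v := by
    intro p v
    -- A linear field through `v` turns `φ ↦ B ⟨p, φ⟩ v` into `φ ↦ γ(ξ)` on the fibre, linear by
    -- hypothesis.
    obtain ⟨ξ, χ, hξ, hχ⟩ := exists_isLinearVectorField p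
      ((trivializationAt E (TangentSpace 𝓘(ℝ, E)) p).continuousLinearMapAt ℝ p v)
    have hχp : χ p = v := hχ.self_of_nhds.trans <|
      Bundle.Trivialization.symmL_continuousLinearMapAt _
        (FiberBundle.mem_baseSet_trivializationAt' p) v
    have h : (fun φ : TangentSpace 𝓘(ℝ, E) p →L[ℝ] ℝ => γ ⟨p, φ⟩ (ξ ⟨p, φ⟩)) =
        fun φ => B ⟨p, φ⟩ v := by
      funext φ
      rw [hB, hξ.proj, hχp]
    rw [← h]
    exact (hγ.linear ξ χ hξ).linear p
  have hinj : ∀ (p : P) (φ : TangentSpace 𝓘(ℝ, E) p →L[ℝ] ℝ), B ⟨p, φ⟩ = 0 → φ = 0 := by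
    intro p φ h
    by_contra hφ
    refine hγ.ne_zero ⟨p, φ⟩ hφ (ContinuousLinearMap.ext fun w => ?_)
    rw [hB, h]
    rfl
  have hA : ∀ p : P, ∃ A : TangentSpace 𝓘(ℝ, E) p ≃L[ℝ] TangentSpace 𝓘(ℝ, E) p,
      ∀ (φ : TangentSpace 𝓘(ℝ, E) p →L[ℝ] ℝ) v, B ⟨p, φ⟩ v = φ (A v) := fun p =>
    exists_transpose (V := E) (hlin p) (hinj p)
  choose A hA using hA
  have hsmooth : SmoothEnd E P (fun p => (A p).toContinuousLinearMap) := by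
    refine (smoothEnd_iff _).2 fun p₀ => contMDiffAt_clm_of_dual_apply fun ψ v => ?_
    obtain ⟨ξ, χ, hξ, hχ⟩ := exists_isLinearVectorField p₀ v
    -- Near `p₀`, `γ(ξ)` along the coordinate-constant section `ψ` is the entry `ψ(A v)` of `A` in
    -- coordinates.
    refine (((hγ.linear ξ χ hξ).smooth _).comp p₀
      (contMDiffAt_constant_section p₀ ψ)).congr_of_eventuallyEq ?_
    filter_upwards [hχ] with p hp
    refine Eq.symm ((hB _ _).trans ?_)
    rw [hξ.proj]
    exact (hA p _ _).trans (by rw [hp]; rfl)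
  refine ⟨⟨A, hsmooth⟩, funext fun φ => ContinuousLinearMap.ext fun w => ?_⟩
  exact ((hB φ w).trans (hA φ.1 φ.2 _)).symm

end Surjectivity

end GenCanForm

end

theorem proposition5 {E : Type*} [NormedAddCommGroup E] [NormedSpace ℝ E] [FiniteDimensional ℝ E]
    {P : Type*} [TopologicalSpace P] [T2Space P] [ChartedSpace E P]
    [IsManifold 𝓘(ℝ, E) ∞ P] :
    -- the map `Θ` is a bijection from `Aut₀ TP` onto `Can T*P`
    Set.BijOn (GenCanForm.Θ : GenCanForm.Aut₀ E P → GenCanForm.OneForm E P)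
      Set.univ (GenCanForm.Can E P) ∧
    -- the maps `A*` along which one pulls back are smooth
    (∀ A : GenCanForm.Aut₀ E P,
      ContMDiff (GenCanForm.cotModel E) (GenCanForm.cotModel E) ∞ (GenCanForm.dual A)) ∧
    -- `L*` is a left action of `Aut₀ TP` on `Can T*P`
    (∀ A : GenCanForm.Aut₀ E P, ∀ γ ∈ GenCanForm.Can E P,
      GenCanForm.Lstar A γ ∈ GenCanForm.Can E P) ∧
    (∀ γ ∈ GenCanForm.Can E P, GenCanForm.Lstar (1 : GenCanForm.Aut₀ E P) γ = γ) ∧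
    (∀ A B : GenCanForm.Aut₀ E P, ∀ γ ∈ GenCanForm.Can E P,
      GenCanForm.Lstar (A * B) γ = GenCanForm.Lstar A (GenCanForm.Lstar B γ)) ∧
    -- the action is transitive
    (∀ γ ∈ GenCanForm.Can E P, ∀ γ' ∈ GenCanForm.Can E P,
      ∃ A : GenCanForm.Aut₀ E P, GenCanForm.Lstar A γ = γ') ∧
    -- the action is free
    (∀ A : GenCanForm.Aut₀ E P, ∀ γ ∈ GenCanForm.Can E P, GenCanForm.Lstar A γ = γ → A = 1) ∧
    -- equivariance of `Θ`
    (∀ A A' : GenCanForm.Aut₀ E P,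
      GenCanForm.Lstar A (GenCanForm.Θ A') = GenCanForm.Θ (A * A')) := by
  -- With each form written as `Θ C`, the claims about the action become group identities via
  -- `Lstar_Θ`.
  have hsurj : ∀ γ ∈ GenCanForm.Can E P, ∃ A : GenCanForm.Aut₀ E P, GenCanForm.Θ A = γ :=
    fun γ hγ => GenCanForm.IsGenCanonical.exists_Θ_eq hγ
  refine ⟨⟨fun A _ => GenCanForm.isGenCanonical_Θ A, GenCanForm.Θ_injective.injOn, fun γ hγ => ?_⟩,
    GenCanForm.contMDiff_dual, ?_, ?_, ?_, ?_, ?_, GenCanForm.Lstar_Θ⟩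
  · obtain ⟨A, rfl⟩ := hsurj γ hγ
    exact ⟨A, Set.mem_univ A, rfl⟩
  · rintro A γ hγ
    obtain ⟨C, rfl⟩ := hsurj γ hγ
    rw [GenCanForm.Lstar_Θ]
    exact GenCanForm.isGenCanonical_Θ _
  · rintro γ hγ
    obtain ⟨C, rfl⟩ := hsurj γ hγ
    rw [GenCanForm.Lstar_Θ, one_mul]
  · rintro A B γ hγ
    obtain ⟨C, rfl⟩ := hsurj γ hγ
    rw [GenCanForm.Lstar_Θ, GenCanForm.Lstar_Θ, GenCanForm.Lstar_Θ, mul_assoc]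
  · rintro γ hγ γ' hγ'
    obtain ⟨C, rfl⟩ := hsurj γ hγ
    obtain ⟨D, rfl⟩ := hsurj γ' hγ'
    exact ⟨D * C⁻¹, by rw [GenCanForm.Lstar_Θ, inv_mul_cancel_right]⟩
  · rintro A γ hγ h
    obtain ⟨C, rfl⟩ := hsurj γ hγ
    rw [GenCanForm.Lstar_Θ] at h
    exact mul_eq_right.1 (GenCanForm.Θ_injective h)
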